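/- **Setting.** Let $\mathrm{Var}$ be a finite set of shared variables, $\mathrm{Val}$ a set of values, and let a memory be a map $mem:\mathrm{Var}\to\mathrm{Val}$. A *mode state* $mds$ assigns to each of the modes $\mathrm{AsmNoW},\mathrm{AsmNoRW},\mathrm{GuarNoW},\mathrm{GuarNoRW}$ a set of variables; write $\mathrm{Readable}\ mds\ x$ for $x\notin mds(\mathrm{AsmNoRW})$ and $\mathrm{Writable}\ mds\ x$ for $x\notin mds(\mathrm{AsmNoW})\cup mds(\mathrm{AsmNoRW})$. A classification $\mathcal L$ assigns to each memory and variable a level High or Low. Each variable $x$ has a set $\mathcal C(x)$ of control variables such that $\mathcal L_{mem}(x)$ depends only on the values $mem(y)$, $y\in\mathcal C(x)$; all variables in $\mathcal C=\bigcup_x\mathcal C(x)$ are Low in every memory. An abstract language $A$ and a concrete language $C$ each have a set of thread-private states and a deterministic step relation $\rightsquigarrow$ on local configurations $\langle tps,mds,mem\rangle$; they share $\mathrm{Var},\mathrm{Val},\mathcal L,\mathcal C(\cdot)$. Let $lc\rightsquigarrow^n lc'$ mean exactly $n$ steps, and let $\mathrm{mds}(lc)$ be the mode state of $lc$. A change of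 memory from $mem$ to $mem'$ is *permitted* by $mds$ if every $x$ with $mem(x)\ne mem'(x)$ or $\mathcal L_{mem}(x)\neq\mathcal L_{mem'}(x)$ is $\mathrm{Writable}$ in $mds$. Write $mem_1=_{\mathrm{Low}}mem_2$ if $mem_1(x)=mem_2(x)$ whenever $\mathcal L_{mem_1}(x)=\mathrm{Low}$, and $mem_1=^{mds}_{\mathrm{Low}}mem_2$ if $mem_1(x)=mem_2(x)$ whenever $x\in\mathcal C$, or $\mathcal L_{mem_1}(x)=\mathrm{Low}$ and $\mathrm{Readable}\ mds\ x$. **Systems.** A system is a finite list $cms$ of pairs $(tps,mds)$, one per thread. A step of thread $n$ (an index into the list) takes $(cms,mem)$ to the configuration obtained by one step of $\langle cms[n],mem\rangle$, replacing $cms[n]$ and $mem$; for a finite list $s$ of thread indices, $\to_s$ is the execution of the corresponding steps in order. $\mathrm{SysSecure}(\mathrm{INIT})\ cms$ says: for all $mem_1=_{\mathrm{Low}}mem_2$ satisfying $\mathrm{INIT}$, all $s$, and all $(cms,mem_1)\to_s(cms_1',mem_1')$, some $(cms_2',mem_2')$ with $(cms,mem_2)\to_s(cms_2',mem_2')$ exists,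 and for every such $(cms_2',mem_2')$ the lists $cms_1',cms_2'$ have equal length and equal lists of mode states, and $mem_1'(x)=mem_2'(x)$ whenever $x\in\mathcal C$, or $\mathcal L_{mem_1'}(x)=\mathrm{Low}$ and $x$ is $\mathrm{Readable}$ in the mode states of all threads of $cms_1'$. **Sound mode use.** A thread-private state $c$ *doesn't write* $x$ if every step $\langle c,mds,mem\rangle\rightsquigarrow\langle c',mds',mem'\rangle$ has $mem(x)=mem'(x)$ and $\mathcal L_{mem}(x)=\mathcal L_{mem'}(x)$. It *doesn't read or write* $x$ if for each such step, each $y\in\{x\}\cup\mathcal C(x)$ and each value $v$, also $\langle c,mds,mem[y:=v]\rangle\rightsquigarrow\langle c',mds',mem'[y:=v]\rangle$. $(c,mds)$ *respects its guarantees* if $c$ doesn't write any $x\in mds(\mathrm{GuarNoW})$ and doesn't read or write any $x\in mds(\mathrm{GuarNoRW})$. $\mathrm{LocalModeUse}(lc)$: every $\langle c,mds,mem\rangle$ reachable from $lc$ by steps and by changes of memory permitted by the current mode state has $(c,mds)$ respecting its guarantees. $\mathrm{GlobalModeUse}(cms,mem)$: in every configuration reached from $(cms,mem)$ under some schedule,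 for all threads $i\ne j$, each $x\in mds_i(\mathrm{AsmNoRW})$ lies in $mds_j(\mathrm{GuarNoRW})$ and each $x\in mds_i(\mathrm{AsmNoW})$ lies in $mds_j(\mathrm{GuarNoW})$. $\mathrm{SoundModeUse}(cms,mem)$: $\mathrm{GlobalModeUse}(cms,mem)$, and $\mathrm{LocalModeUse}\langle cm,mem\rangle$ for every $cm$ in $cms$. **Per-thread relations.** A relation $\mathcal B$ on local configurations of one language is *cg-consistent* if $(\langle tps_1,mds,mem_1\rangle,\langle tps_2,mds,mem_2\rangle)\in\mathcal B$ implies $(\langle tps_1,mds,mem_1'\rangle,\langle tps_2,mds,mem_2'\rangle)\in\mathcal B$ whenever $mem_1'=^{mds}_{\mathrm{Low}}mem_2'$ and every $x$ with $mem_1(x)\neq mem_1'(x)$, $mem_2(x)\ne mem_2'(x)$ or $\mathcal L_{mem_1}(x)\neq\mathcal L_{mem_1'}(x)$ is $\mathrm{Writable}$ in $mds$. $\mathcal B$ is a *strong low bisimulation modulo modes* if it is cg-consistent, symmetric, and any $(lc_1,lc_2)\in\mathcal B$ with equal mode state $mds$ have memories related by $=^{mds}_{\mathrm{Low}}$ and,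 for each $lc_1\rightsquigarrow lc_1'$, there is $lc_2\rightsquigarrow lc_2'$ with $(lc_1',lc_2')\in\mathcal B$ and equal mode states. Let $\mathcal B$ relate abstract configurations to abstract ones, $\mathcal R$ abstract to concrete, $\mathcal I$ concrete to concrete. $\mathrm{SysRefineReqs}\ \mathcal B\ \mathcal R\ \mathcal I$, for a predicate $\mathrm{INIT}_C$ on memories, is the conjunction of: 1. $\mathcal R$-related configurations have equal mode states and equal memories; 2. if $(\langle tps_A,mds,mem\rangle,\langle tps_C,mds,mem\rangle)\in\mathcal R$ and the change from $mem$ to $mem'$ is permitted by $mds$, then $(\langle tps_A,mds,mem'\rangle,\langle tps_C,mds,mem'\rangle)\in\mathcal R$; 3. $\mathcal I$ is cg-consistent and symmetric; 4. if $(lc_{1A},lc_{1C})\in\mathcal R$ and $lc_{1C}\rightsquigarrow lc_{1C}'$, there are $n$ and $lc_{1A}'$ with $lc_{1A}\rightsquigarrow^n lc_{1A}'$ and $(lc_{1A}',lc_{1C}')\in\mathcal R$ such that, for all $lc_{2A},lc_{2C},lc_{2A}'$ with $(lc_{1A},lc_{2A})\in\mathcal B$, $(lc_{2A},lc_{2C})\in\mathcal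 R$, $(lc_{1C},lc_{2C})\in\mathcal I$, $lc_{2A}\rightsquigarrow^n lc_{2A}'$, $\mathrm{mds}(lc_{1A})=\mathrm{mds}(lc_{2A})$, $\mathrm{mds}(lc_{1C})=\mathrm{mds}(lc_{2C})$ and $\mathrm{mds}(lc_{1A}')=\mathrm{mds}(lc_{2A}')$, there is $lc_{2C}\rightsquigarrow lc_{2C}'$ with $\mathrm{mds}(lc_{1C}')=\mathrm{mds}(lc_{2C}')$, $(lc_{2A}',lc_{2C}')\in\mathcal R$ and $(lc_{1C}',lc_{2C}')\in\mathcal I$; 5. $\mathcal B$ is a strong low bisimulation modulo modes; 6. if $(\langle tps_A,mds_A,mem_A\rangle,\langle tps_C,mds_C,mem_C\rangle)\in\mathcal R$ and $(tps_A,mds_A)$ respects its guarantees, so does $(tps_C,mds_C)$; 7. $(\langle tps_C,mds,mem_1\rangle,\langle tps_C,mds,mem_2\rangle)\in\mathcal I$ for all $tps_C,mds$ and all $mem_1=^{mds}_{\mathrm{Low}}mem_2$ satisfying $\mathrm{INIT}_C$. **Theorem (whole-system compositionality of per-thread secure refinement).** Let $\mathrm{INIT}_A,\mathrm{INIT}_C$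 be predicates on memories, $cms_A$ and $cms_C$ an abstract and a concrete system, and $\mathcal Bs,\mathcal Rs,\mathcal Is$ lists of relations, all five lists of the same length. Suppose that $\mathrm{INIT}_C\ mem$ implies $\mathrm{INIT}_A\ mem$ for all $mem$, that $\mathrm{INIT}_A\ mem$ implies $\mathrm{SoundModeUse}(cms_A,mem)$ for all $mem$, and that for each thread $i$: * $\mathrm{SysRefineReqs}\ \mathcal Bs[i]\ \mathcal Rs[i]\ \mathcal Is[i]$ holds; * $(\langle cms_A[i],mem\rangle,\langle cms_C[i],mem\rangle)\in\mathcal Rs[i]$ for all $mem$ satisfying $\mathrm{INIT}_C$; * $(\langle cms_A[i],mem_1\rangle,\langle cms_A[i],mem_2\rangle)\in\mathcal Bs[i]$ for all $mem_1,mem_2$ satisfying $\mathrm{INIT}_A$ with $mem_1=^{mds}_{\mathrm{Low}}mem_2$, where $mds$ is the mode state of $cms_C[i]$. Then $\mathrm{SysSecure}(\mathrm{INIT}_C)\ cms_C$ holds, and $\mathrm{GlobalModeUse}(cms_C,mem)$ holds for every $mem$ satisfying $\mathrm{INIT}_C$. -/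

import Mathlib

namespace CVDNI

/-- Security levels of shared variables. -/
inductive Level where
  | high
  | low

/-- Access modes: assumptions about the other threads, and guarantees given to them. -/
inductive Mode where
  | asmNoW
  | asmNoRW
  | guarNoW
  | guarNoRW

/-- An (assume-guarantee) mode state. -/
abbrev ModeState (Var : Type*) := Mode → Set Var

/-- Shared memories: total maps from shared variables to values. -/
abbrev Mem (Var Val : Type*) := Var → Val

/-- A thread-private state together with a mode state. -/
abbrev ThreadConf (Tps Var : Type*) := Tps × ModeState Var

/-- Local configurations `⟨tps, mds, mem⟩`, written `((tps, mds), mem)`. -/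
abbrev LocalConf (Tps Var Val : Type*) := ThreadConf Tps Var × Mem Var Val

/-- Global configurations `(cms, mem)`. -/
abbrev GlobalConf (Tps Var Val : Type*) := List (ThreadConf Tps Var) × Mem Var Val

/-- A value-dependent classification of the shared variables, with the control variables of each
variable: the classification of `x` depends only on the values of the control variables of `x`,
and every control variable is classified low in every memory. -/
structure Classification (Var Val : Type*) where
  dma : Mem Var Val → Var → Level
  controlVars : Var → Set Var
  dma_congr : ∀ (x : Var) (mem₁ mem₂ : Mem Var Val),
    (∀ y ∈ controlVars x, mem₁ y = mem₂ y) → dma mem₁ x = dma mem₂ x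
  dma_controlVars : ∀ (x : Var), ∀ y ∈ controlVars x, ∀ mem : Mem Var Val, dma mem y = Level.low

/-- A deterministic evaluation-step semantics for threads. -/
structure Semantics (Tps Var Val : Type*) where
  step : LocalConf Tps Var Val → LocalConf Tps Var Val → Prop
  deterministic : ∀ {lc lc₁ lc₂ : LocalConf Tps Var Val}, step lc lc₁ → step lc lc₂ → lc₁ = lc₂

section Equivalences

variable {Var Val : Type*} (K : Classification Var Val)

/-- The set of all control variables in the system. -/
def allControlVars : Set Var := {y | ∃ x, y ∈ K.controlVars x}

def Readable (mds : ModeState Var) (x : Var) : Prop := x ∉ mds Mode.asmNoRW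

def Writable (mds : ModeState Var) (x : Var) : Prop :=
  x ∉ mds Mode.asmNoW ∧ x ∉ mds Mode.asmNoRW

/-- Low-equivalence of memories. -/
def LowEq (mem₁ mem₂ : Mem Var Val) : Prop :=
  ∀ x, K.dma mem₁ x = Level.low → mem₁ x = mem₂ x

/-- Low-equivalence of memories modulo a mode state. -/
def LowEqModulo (mds : ModeState Var) (mem₁ mem₂ : Mem Var Val) : Prop :=
  ∀ x, (x ∈ allControlVars K ∨ (K.dma mem₁ x = Level.low ∧ Readable mds x)) → mem₁ x = mem₂ x

end Equivalences

section LocalConfigurations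

variable {Tps TpsA TpsC Var Val : Type*}

/-- Equality of the mode states of two local configurations, possibly of different languages. -/
def SameMds (lc₁ : LocalConf TpsA Var Val) (lc₂ : LocalConf TpsC Var Val) : Prop :=
  lc₁.1.2 = lc₂.1.2

/-- Equality of mode states and of memories, possibly across different languages. -/
def SameMdsMem (lc₁ : LocalConf TpsA Var Val) (lc₂ : LocalConf TpsC Var Val) : Prop :=
  lc₁.1.2 = lc₂.1.2 ∧ lc₁.2 = lc₂.2

/-- Equal mode states, and low-equivalent memories modulo that mode state. -/
def LowEqModuloMds (K : Classification Var Val) (lc₁ lc₂ : LocalConf Tps Var Val) : Prop :=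
  SameMds lc₁ lc₂ ∧ LowEqModulo K lc₁.1.2 lc₁.2 lc₂.2

/-- Closedness under globally consistent changes. -/
def CgConsistent (K : Classification Var Val)
    (B : LocalConf Tps Var Val → LocalConf Tps Var Val → Prop) : Prop :=
  ∀ (tps₁ : Tps) (mem₁ : Mem Var Val) (tps₂ : Tps) (mem₂ : Mem Var Val) (mds : ModeState Var),
    B ((tps₁, mds), mem₁) ((tps₂, mds), mem₂) →
    ∀ mem₁' mem₂' : Mem Var Val,
      (∀ x, (mem₁ x ≠ mem₁' x ∨ mem₂ x ≠ mem₂' x ∨ K.dma mem₁ x ≠ K.dma mem₁' x) →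
        Writable mds x) →
      LowEqModulo K mds mem₁' mem₂' →
      B ((tps₁, mds), mem₁') ((tps₂, mds), mem₂')

/-- Symmetry of a relation on local configurations. -/
def Sym (B : LocalConf Tps Var Val → LocalConf Tps Var Val → Prop) : Prop :=
  ∀ lc₁ lc₂, B lc₁ lc₂ → B lc₂ lc₁

/-- Strong low bisimulation, modulo modes. -/
def StrongLowBisimMM (K : Classification Var Val) (S : Semantics Tps Var Val)
    (B : LocalConf Tps Var Val → LocalConf Tps Var Val → Prop) : Prop :=
  CgConsistent K B ∧ Sym B ∧
  ∀ lc₁ lc₂, B lc₁ lc₂ → SameMds lc₁ lc₂ →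
    LowEqModuloMds K lc₁ lc₂ ∧
    ∀ lc₁', S.step lc₁ lc₁' → ∃ lc₂', S.step lc₂ lc₂' ∧ SameMds lc₁' lc₂' ∧ B lc₁' lc₂'

/-- Exactly `n` evaluation steps. -/
inductive NStep (S : Semantics Tps Var Val) :
    ℕ → LocalConf Tps Var Val → LocalConf Tps Var Val → Prop
  | zero (lc : LocalConf Tps Var Val) : NStep S 0 lc lc
  | succ {n : ℕ} {lc lc' lc'' : LocalConf Tps Var Val} :
      S.step lc lc' → NStep S n lc' lc'' → NStep S (n + 1) lc lc''

end LocalConfigurations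

section GlobalConfigurations

variable {Tps Var Val : Type*}

/-- The `n`th thread of a global configuration takes one step. -/
def SchedStep (S : Semantics Tps Var Val) (n : ℕ) (gc gc' : GlobalConf Tps Var Val) : Prop :=
  ∃ (h : n < gc.1.length) (cm' : ThreadConf Tps Var) (mem' : Mem Var Val),
    S.step (gc.1[n], gc.2) (cm', mem') ∧ gc' = (gc.1.set n cm', mem')

/-- Evaluation of a global configuration under a fixed finite schedule. -/
def EvalSched (S : Semantics Tps Var Val) :
    List ℕ → GlobalConf Tps Var Val → GlobalConf Tps Var Val → Prop
  | [], gc, gc' => gc = gc'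
  | n :: ns, gc, gc' => ∃ gc'', SchedStep S n gc gc'' ∧ EvalSched S ns gc'' gc'

/-- Whole-system value-dependent security, with initialisation requirement `INIT`. -/
def SysSecure (K : Classification Var Val) (S : Semantics Tps Var Val)
    (INIT : Mem Var Val → Prop) (cms : List (ThreadConf Tps Var)) : Prop :=
  ∀ mem₁ mem₂ : Mem Var Val, INIT mem₁ → INIT mem₂ → LowEq K mem₁ mem₂ →
    ∀ (sched : List ℕ) (cms₁' : List (ThreadConf Tps Var)) (mem₁' : Mem Var Val),
      EvalSched S sched (cms, mem₁) (cms₁', mem₁') →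
      (∃ (cms₂' : List (ThreadConf Tps Var)) (mem₂' : Mem Var Val),
        EvalSched S sched (cms, mem₂) (cms₂', mem₂')) ∧
      ∀ (cms₂' : List (ThreadConf Tps Var)) (mem₂' : Mem Var Val),
        EvalSched S sched (cms, mem₂) (cms₂', mem₂') →
        cms₁'.length = cms₂'.length ∧
        cms₁'.map Prod.snd = cms₂'.map Prod.snd ∧
        ∀ x, (x ∈ allControlVars K ∨
            (K.dma mem₁' x = Level.low ∧
              ∀ (i : ℕ) (h : i < cms₁'.length), Readable cms₁'[i].2 x)) →
          mem₁' x = mem₂' x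

/-- The local configurations reachable from `lc` by evaluation steps and by changes that other
threads may make: changes to the value or the classification of writable variables only. -/
inductive LocReach (K : Classification Var Val) (S : Semantics Tps Var Val)
    (lc : LocalConf Tps Var Val) : LocalConf Tps Var Val → Prop
  | refl : LocReach K S lc lc
  | step {lc' lc'' : LocalConf Tps Var Val} :
      LocReach K S lc lc' → S.step lc' lc'' → LocReach K S lc lc''
  | memDiff {tps : Tps} {mds : ModeState Var} {mem mem' : Mem Var Val} :
      LocReach K S lc ((tps, mds), mem) →
      (∀ x, (mem x ≠ mem' x ∨ K.dma mem x ≠ K.dma mem' x) → Writable mds x) →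
      LocReach K S lc ((tps, mds), mem')

open Classical in
/-- A step from the thread-private state `c` neither reads nor writes `x` or any control variable
of `x`: replacing the value of such a variable beforehand by any `v` yields the same step, with
the variable still holding `v` afterwards. -/
def DoesntRW (K : Classification Var Val) (S : Semantics Tps Var Val) (c : Tps) (x : Var) : Prop :=
  ∀ (mds : ModeState Var) (mem : Mem Var Val) (c' : Tps) (mds' : ModeState Var)
    (mem' : Mem Var Val),
    S.step ((c, mds), mem) ((c', mds'), mem') →
    ∀ y ∈ insert x (K.controlVars x), ∀ v : Val,
      S.step ((c, mds), Function.update mem y v) ((c', mds'), Function.update mem' y v)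

/-- A step from the thread-private state `c` changes neither the value nor the classification
of `x`. -/
def DoesntW (K : Classification Var Val) (S : Semantics Tps Var Val) (c : Tps) (x : Var) : Prop :=
  ∀ (mds : ModeState Var) (mem : Mem Var Val) (c' : Tps) (mds' : ModeState Var)
    (mem' : Mem Var Val),
    S.step ((c, mds), mem) ((c', mds'), mem') → mem x = mem' x ∧ K.dma mem x = K.dma mem' x

def RespectsOwnGuars (K : Classification Var Val) (S : Semantics Tps Var Val)
    (cm : ThreadConf Tps Var) : Prop :=
  ∀ x, (x ∈ cm.2 Mode.guarNoRW → DoesntRW K S cm.1 x) ∧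
    (x ∈ cm.2 Mode.guarNoW → DoesntW K S cm.1 x)

/-- Local mode compliance. -/
def LocalModeUse (K : Classification Var Val) (S : Semantics Tps Var Val)
    (lc : LocalConf Tps Var Val) : Prop :=
  ∀ (c : Tps) (mds : ModeState Var) (mem : Mem Var Val),
    LocReach K S lc ((c, mds), mem) → RespectsOwnGuars K S (c, mds)

def ReachableMdsLists (S : Semantics Tps Var Val) (gc : GlobalConf Tps Var Val) :
    Set (List (ModeState Var)) :=
  {mdss | ∃ (cms' : List (ThreadConf Tps Var)) (mem' : Mem Var Val) (sched : List ℕ),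
    EvalSched S sched gc (cms', mem') ∧ cms'.map Prod.snd = mdss}

def CompatibleModes (mdss : List (ModeState Var)) : Prop :=
  ∀ (i : ℕ) (x : Var) (hi : i < mdss.length),
    (x ∈ mdss[i] Mode.asmNoRW →
      ∀ (j : ℕ) (hj : j < mdss.length), j ≠ i → x ∈ mdss[j] Mode.guarNoRW) ∧
    (x ∈ mdss[i] Mode.asmNoW →
      ∀ (j : ℕ) (hj : j < mdss.length), j ≠ i → x ∈ mdss[j] Mode.guarNoW)

/-- Global modes compatibility. -/
def GlobalModeUse (S : Semantics Tps Var Val) (gc : GlobalConf Tps Var Val) : Prop :=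
  ∀ mdss ∈ ReachableMdsLists S gc, CompatibleModes mdss

/-- Sound mode use. -/
def SoundModeUse (K : Classification Var Val) (S : Semantics Tps Var Val)
    (gc : GlobalConf Tps Var Val) : Prop :=
  (∀ cm ∈ gc.1, LocalModeUse K S (cm, gc.2)) ∧ GlobalModeUse S gc

end GlobalConfigurations

section Refinement

variable {TpsA TpsC Var Val : Type*}

/-- Preservation of modes and memory. -/
def PreservesModesMem (R : LocalConf TpsA Var Val → LocalConf TpsC Var Val → Prop) : Prop :=
  ∀ lcA lcC, R lcA lcC → SameMdsMem lcA lcC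

/-- Closedness of refinements under changes by others. -/
def ClosedOthers (K : Classification Var Val)
    (R : LocalConf TpsA Var Val → LocalConf TpsC Var Val → Prop) : Prop :=
  ∀ (tpsA : TpsA) (tpsC : TpsC) (mds : ModeState Var) (mem mem' : Mem Var Val),
    R ((tpsA, mds), mem) ((tpsC, mds), mem) →
    (∀ x, (mem x ≠ mem' x ∨ K.dma mem x ≠ K.dma mem' x) → Writable mds x) →
    R ((tpsA, mds), mem') ((tpsC, mds), mem')

/-- The cube-shaped preservation obligation for the refinement relation `R` and the coupling
invariant `I`. -/
def CouplingInvPres (SA : Semantics TpsA Var Val) (SC : Semantics TpsC Var Val)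
    (B : LocalConf TpsA Var Val → LocalConf TpsA Var Val → Prop)
    (R : LocalConf TpsA Var Val → LocalConf TpsC Var Val → Prop)
    (I : LocalConf TpsC Var Val → LocalConf TpsC Var Val → Prop) : Prop :=
  ∀ lc1A lc1C, R lc1A lc1C →
    ∀ lc1C', SC.step lc1C lc1C' →
      ∃ (n : ℕ) (lc1A' : LocalConf TpsA Var Val), NStep SA n lc1A lc1A' ∧ R lc1A' lc1C' ∧
        ∀ lc2A lc2C lc2A',
          B lc1A lc2A → SameMds lc1A lc2A →
          R lc2A lc2C → I lc1C lc2C →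
          SameMds lc1C lc2C → NStep SA n lc2A lc2A' → SameMds lc1A' lc2A' →
          ∃ lc2C', SC.step lc2C lc2C' ∧ SameMds lc1C' lc2C' ∧ R lc2A' lc2C' ∧ I lc1C' lc2C'

/-- Requirements for confidentiality-preserving secure refinement. -/
def SecureRefinement (K : Classification Var Val)
    (SA : Semantics TpsA Var Val) (SC : Semantics TpsC Var Val)
    (B : LocalConf TpsA Var Val → LocalConf TpsA Var Val → Prop)
    (R : LocalConf TpsA Var Val → LocalConf TpsC Var Val → Prop)
    (I : LocalConf TpsC Var Val → LocalConf TpsC Var Val → Prop) : Prop :=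
  PreservesModesMem R ∧ ClosedOthers K R ∧ CgConsistent K I ∧ Sym I ∧
    CouplingInvPres SA SC B R I

/-- The refinement preserves local mode compliance. -/
def PreservesLocalCompliance (K : Classification Var Val)
    (SA : Semantics TpsA Var Val) (SC : Semantics TpsC Var Val)
    (R : LocalConf TpsA Var Val → LocalConf TpsC Var Val → Prop) : Prop :=
  ∀ (tpsA : TpsA) (mdsA : ModeState Var) (memA : Mem Var Val)
    (tpsC : TpsC) (mdsC : ModeState Var) (memC : Mem Var Val),
    RespectsOwnGuars K SA (tpsA, mdsA) →
    R ((tpsA, mdsA), memA) ((tpsC, mdsC), memC) →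
    RespectsOwnGuars K SC (tpsC, mdsC)

/-- Requirements for compositional whole-system refinement. -/
def SysRefineReqs (K : Classification Var Val)
    (SA : Semantics TpsA Var Val) (SC : Semantics TpsC Var Val) (INITC : Mem Var Val → Prop)
    (B : LocalConf TpsA Var Val → LocalConf TpsA Var Val → Prop)
    (R : LocalConf TpsA Var Val → LocalConf TpsC Var Val → Prop)
    (I : LocalConf TpsC Var Val → LocalConf TpsC Var Val → Prop) : Prop :=
  SecureRefinement K SA SC B R I ∧ StrongLowBisimMM K SA B ∧
  PreservesLocalCompliance K SA SC R ∧
  ∀ (tpsC : TpsC) (mds : ModeState Var) (mem₁ mem₂ : Mem Var Val),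
    LowEqModulo K mds mem₁ mem₂ → INITC mem₁ → INITC mem₂ →
    I ((tpsC, mds), mem₁) ((tpsC, mds), mem₂)

end Refinement

end CVDNI

open CVDNI

namespace CVDNI

/-! ### Steps and variables that are neither read nor written -/

section SingleLanguage

variable {Tps Var Val : Type*} {K : Classification Var Val} {S : Semantics Tps Var Val}

/-! The proof has two halves: a compositionality theorem for a single language, and the transfer of
its hypotheses from the abstract to the concrete system.

Compositionality (`sysSecure_of_strongLowBisimMM`) runs the system from two low-equal memories. A
thread with exclusive access to a low variable `x` may store a secret there. The bisimulations of
the other threads then fail on the real memories, since `x` can still count as readable in their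
mode states. But those threads guarantee not to touch `x`, so for thread `i` one may pretend that a
set `D i` of such variables holds the same values, those of a fixed memory `σ`, in both runs.
`Coupled` records this. Every low variable that differs lies outside some `D i`; the bisimulation of
that owner `i` shows that `i` cannot read it, so `i` assumes `AsmNoRW`, and compatibility of modes
makes all other threads guarantee `GuarNoRW`. Hence steps pass between real and overridden memories
(`step_piecewise`), and coupling survives each step (`Coupled.schedStep`). A differing low variable
is therefore never readable by all threads.

For the transfer, abstract bisimulation, refinement and coupling invariant compose to a concrete
bisimulation (`strongLowBisimMM_concreteRel`). Each concrete execution is simulated by an abstract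
one with the same memory and mode states, so sound mode use descends as well
(`SoundModeUse.refine`). -/

theorem dma_eq_of_eqOn_controlVars {m₁ m₂ : Mem Var Val}
    (h : ∀ x ∈ allControlVars K, m₁ x = m₂ x) (x : Var) : K.dma m₁ x = K.dma m₂ x :=
  K.dma_congr x m₁ m₂ fun y hy => h y ⟨x, hy⟩

/-- Overwriting `y` with the value it already holds does not alter the start of the step, so by
determinism it cannot alter the end either. -/
theorem DoesntRW.eq_of_step {c : Tps} {x : Var} (h : DoesntRW K S c x)
    {mds : ModeState Var} {mem : Mem Var Val} {cm' : ThreadConf Tps Var} {mem' : Mem Var Val}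
    (hs : S.step ((c, mds), mem) (cm', mem')) {y : Var} (hy : y ∈ insert x (K.controlVars x)) :
    mem y = mem' y := by
  classical
  have h1 := h mds mem cm'.1 cm'.2 mem' hs y hy (mem y)
  have h2 : S.step ((c, mds), mem)
      ((cm'.1, cm'.2), Function.update mem' y (mem y)) := by
    convert h1 using 2
    exact (Function.update_eq_self y mem).symm
  have h3 := congrArg (fun z => z.2 y) (S.deterministic h2 hs)
  simpa using h3

theorem DoesntRW.doesntW {c : Tps} {x : Var} (h : DoesntRW K S c x) : DoesntW K S c x := by
  intro mds mem c' mds' mem' hs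
  exact ⟨h.eq_of_step hs (Set.mem_insert _ _),
    K.dma_congr x mem mem' fun y hy => h.eq_of_step hs (Set.mem_insert_of_mem _ hy)⟩

open Classical in
/-- A step is insensitive to the values of any set of variables that it neither reads nor
writes. -/
theorem step_piecewise [Finite Var] {cm cm' : ThreadConf Tps Var} {mem mem' : Mem Var Val}
    (D : Set Var) (hD : ∀ x ∈ D, DoesntRW K S cm.1 x) (hs : S.step (cm, mem) (cm', mem'))
    (σ : Mem Var Val) : S.step (cm, D.piecewise σ mem) (cm', D.piecewise σ mem') := by
  -- `DoesntRW` overwrites one variable at a time; finiteness of `Var` lets this reach all of `D`.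
  induction D, D.toFinite using Set.Finite.induction_on with
  | empty => simpa using hs
  | @insert a s _ _ ih =>
    have h1 := ih fun x hx => hD x (Set.mem_insert_of_mem _ hx)
    have h2 := hD a (Set.mem_insert _ _) cm.2 _ cm'.1 cm'.2 _ h1 a (Set.mem_insert _ _) (σ a)
    rw [Set.piecewise_insert, Set.piecewise_insert]
    convert h2 using 2

/-! ### Sound mode use along executions -/

theorem CompatibleModes.guar_of_not_writable {cms : List (ThreadConf Tps Var)}
    (h : CompatibleModes (cms.map Prod.snd)) {i j : ℕ} (hi : i < cms.length)
    (hj : j < cms.length) (hij : j ≠ i) {x : Var} (hx : ¬ Writable cms[i].2 x) :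
    x ∈ cms[j].2 Mode.guarNoW ∨ x ∈ cms[j].2 Mode.guarNoRW := by
  have h1 := h i x (by simpa using hi)
  simp only [List.getElem_map, List.length_map] at h1
  by_cases hw : x ∈ cms[i].2 Mode.asmNoW
  · exact Or.inl (h1.2 hw j hj hij)
  · exact Or.inr (h1.1 (by_contra fun hn => hx ⟨hw, hn⟩) j hj hij)

/-- The steps of one thread only make changes that every other thread permits. -/
theorem writable_of_step {cms : List (ThreadConf Tps Var)}
    (h : CompatibleModes (cms.map Prod.snd)) {i j : ℕ} (hi : i < cms.length)
    (hj : j < cms.length) (hij : j ≠ i) {SJ : Semantics Tps Var Val}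
    (hg : RespectsOwnGuars K SJ cms[j])
    {mem mem' : Mem Var Val} {cm' : ThreadConf Tps Var} (hs : SJ.step (cms[j], mem) (cm', mem'))
    {x : Var} (hx : mem x ≠ mem' x ∨ K.dma mem x ≠ K.dma mem' x) : Writable cms[i].2 x := by
  by_contra hw
  have h1 : DoesntW K SJ cms[j].1 x := by
    rcases h.guar_of_not_writable hi hj hij hw with h2 | h2
    · exact (hg x).2 h2
    · exact ((hg x).1 h2).doesntW
  have h2 := h1 cms[j].2 mem cm'.1 cm'.2 mem' hs
  rcases hx with hx | hx
  · exact hx h2.1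
  · exact hx h2.2

theorem LocReach.trans {a b c : LocalConf Tps Var Val} (h₁ : LocReach K S a b)
    (h₂ : LocReach K S b c) : LocReach K S a c := by
  induction h₂ with
  | refl => exact h₁
  | step _ hs ih => exact ih.step hs
  | memDiff _ hm ih => exact ih.memDiff hm

theorem LocalModeUse.of_locReach {a b : LocalConf Tps Var Val} (h : LocalModeUse K S a)
    (hr : LocReach K S a b) : LocalModeUse K S b :=
  fun c mds mem hc => h c mds mem (hr.trans hc)

theorem LocalModeUse.respects {cm : ThreadConf Tps Var} {mem : Mem Var Val}
    (h : LocalModeUse K S (cm, mem)) : RespectsOwnGuars K S cm :=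
  h cm.1 cm.2 mem .refl

theorem SoundModeUse.compatible {cms : List (ThreadConf Tps Var)} {mem : Mem Var Val}
    (h : SoundModeUse K S (cms, mem)) : CompatibleModes (cms.map Prod.snd) :=
  h.2 _ ⟨cms, mem, [], rfl, rfl⟩

theorem SoundModeUse.respects {cms : List (ThreadConf Tps Var)} {mem : Mem Var Val}
    (h : SoundModeUse K S (cms, mem)) {i : ℕ} (hi : i < cms.length) :
    RespectsOwnGuars K S cms[i] :=
  (h.1 _ (List.getElem_mem hi)).respects

/-- To a thread other than `k`, the step is a permitted memory change, which local reachability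
already includes. -/
theorem SoundModeUse.schedStep {gc gc' : GlobalConf Tps Var Val} {k : ℕ}
    (h : SoundModeUse K S gc) (hs : SchedStep S k gc gc') : SoundModeUse K S gc' := by
  obtain ⟨cms, mem⟩ := gc
  refine ⟨?_, ?_⟩
  · obtain ⟨hk, cm', mem', hst, rfl⟩ := hs
    simp only at hk hst ⊢
    intro cm hcm
    obtain ⟨i, hi, rfl⟩ := List.mem_iff_getElem.1 hcm
    rw [List.length_set] at hi
    rw [List.getElem_set]
    split_ifs with hki
    · exact (h.1 _ (List.getElem_mem hk)).of_locReach (.step .refl hst)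
    · refine (h.1 _ (List.getElem_mem hi)).of_locReach ?_
      exact .memDiff (tps := cms[i].1) (mds := cms[i].2) .refl
        fun x hx => writable_of_step h.compatible hi hk hki (h.respects hk) hst hx
  · rintro mdss ⟨cms', mem', sched, he, hm⟩
    exact h.2 _ ⟨cms', mem', k :: sched, ⟨gc', hs, he⟩, hm⟩

theorem SoundModeUse.evalSched {s : List ℕ} : ∀ {gc gc' : GlobalConf Tps Var Val},
    SoundModeUse K S gc → EvalSched S s gc gc' → SoundModeUse K S gc' := by
  induction s with
  | nil => rintro gc gc' h rfl; exact h
  | cons k s ih => rintro gc gc' h ⟨gc'', h1, h2⟩; exact ih (h.schedStep h1) h2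

/-! ### Determinism, and runs of several steps -/

theorem SchedStep.deterministic {k : ℕ} {gc gc₁ gc₂ : GlobalConf Tps Var Val}
    (h₁ : SchedStep S k gc gc₁) (h₂ : SchedStep S k gc gc₂) : gc₁ = gc₂ := by
  obtain ⟨hk, cm₁, m₁, hs₁, rfl⟩ := h₁
  obtain ⟨_, cm₂, m₂, hs₂, rfl⟩ := h₂
  cases S.deterministic hs₁ hs₂
  rfl

theorem EvalSched.deterministic {s : List ℕ} : ∀ {gc gc₁ gc₂ : GlobalConf Tps Var Val},
    EvalSched S s gc gc₁ → EvalSched S s gc gc₂ → gc₁ = gc₂ := by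
  induction s with
  | nil => rintro gc gc₁ gc₂ rfl rfl; rfl
  | cons k s ih =>
    rintro gc gc₁ gc₂ ⟨g₁, h₁, e₁⟩ ⟨g₂, h₂, e₂⟩
    cases h₁.deterministic h₂
    exact ih e₁ e₂

theorem EvalSched.append {s t : List ℕ} : ∀ {gc gc₁ gc₂ : GlobalConf Tps Var Val},
    EvalSched S s gc gc₁ → EvalSched S t gc₁ gc₂ → EvalSched S (s ++ t) gc gc₂ := by
  induction s with
  | nil => rintro gc gc₁ gc₂ rfl h; exact h
  | cons k s ih =>
    rintro gc gc₁ gc₂ ⟨g₁, h₁, e₁⟩ h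
    exact ⟨g₁, h₁, ih e₁ h⟩

theorem NStep.evalSched {n k : ℕ} {lc lc' : LocalConf Tps Var Val} (h : NStep S n lc lc') :
    ∀ {cms : List (ThreadConf Tps Var)} (hk : k < cms.length), lc.1 = cms[k] →
      EvalSched S (List.replicate n k) (cms, lc.2) (cms.set k lc'.1, lc'.2) := by
  induction h with
  | zero lc => intro cms hk he; simp [EvalSched, he]
  | @succ n lc lc₁ lc₂ hs _ ih =>
    intro cms hk he
    refine ⟨(cms.set k lc₁.1, lc₁.2), ⟨hk, lc₁.1, lc₁.2, ?_, rfl⟩, ?_⟩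
    · simpa [← he] using hs
    · simpa using ih (cms := cms.set k lc₁.1) (by simpa using hk) (by simp)

theorem NStep.locReach {n : ℕ} {lc lc' : LocalConf Tps Var Val} (h : NStep S n lc lc') :
    LocReach K S lc lc' := by
  induction h with
  | zero lc => exact .refl
  | succ hs _ ih => exact (LocReach.step .refl hs).trans ih

/-- Needed because one concrete step may correspond to any number of abstract steps. -/
theorem StrongLowBisimMM.nStep {B : LocalConf Tps Var Val → LocalConf Tps Var Val → Prop}
    (hB : StrongLowBisimMM K S B) {n : ℕ} {lc₁ lc₁' : LocalConf Tps Var Val}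
    (h : NStep S n lc₁ lc₁') : ∀ {lc₂}, B lc₁ lc₂ → SameMds lc₁ lc₂ →
      ∃ lc₂', NStep S n lc₂ lc₂' ∧ SameMds lc₁' lc₂' ∧ B lc₁' lc₂' := by
  induction h with
  | zero lc => intro lc₂ h1 h2; exact ⟨lc₂, .zero _, h2, h1⟩
  | succ hs _ ih =>
    intro lc₂ h1 h2
    obtain ⟨lc₂', hs', hm, hb⟩ := (hB.2.2 _ _ h1 h2).2 _ hs
    obtain ⟨lc₂'', hs'', h⟩ := ih hb hm
    exact ⟨lc₂'', .succ hs' hs'', h⟩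

/-! ### Coupled runs and compositionality -/

/-- The low variables on which two memories differ. -/
def lowDiff (K : Classification Var Val) (mem₁ mem₂ : Mem Var Val) : Set Var :=
  {x | K.dma mem₁ x = Level.low ∧ mem₁ x ≠ mem₂ x}

open Classical in
/-- The coupling of two runs: thread `i` is related by `B i` once the variables of `D i`, low
variables that some other thread has exclusive access to, are overridden by `σ`. -/
structure Coupled (K : Classification Var Val)
    (B : ℕ → LocalConf Tps Var Val → LocalConf Tps Var Val → Prop) (σ : Mem Var Val)
    (D : ℕ → Set Var) (gc₁ gc₂ : GlobalConf Tps Var Val) : Prop where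
  mds_eq : gc₁.1.map Prod.snd = gc₂.1.map Prod.snd
  control_eq : ∀ x ∈ allControlVars K, gc₁.2 x = gc₂.2 x
  subset : ∀ i, D i ⊆ lowDiff K gc₁.2 gc₂.2
  owner : ∀ x ∈ lowDiff K gc₁.2 gc₂.2, ∃ i < gc₁.1.length, x ∉ D i
  rel : ∀ i (h₁ : i < gc₁.1.length) (h₂ : i < gc₂.1.length),
    B i (gc₁.1[i], (D i).piecewise σ gc₁.2) (gc₂.1[i], (D i).piecewise σ gc₂.2)

namespace Coupled

variable {B : ℕ → LocalConf Tps Var Val → LocalConf Tps Var Val → Prop} {σ : Mem Var Val}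
  {D : ℕ → Set Var} {gc₁ gc₂ : GlobalConf Tps Var Val}

theorem length_eq (h : Coupled K B σ D gc₁ gc₂) : gc₁.1.length = gc₂.1.length := by
  simpa using congrArg List.length h.mds_eq

theorem getElem_mds_eq (h : Coupled K B σ D gc₁ gc₂) {i : ℕ} (h₁ : i < gc₁.1.length)
    (h₂ : i < gc₂.1.length) : gc₁.1[i].2 = gc₂.1[i].2 := by
  have h3 : (gc₁.1.map Prod.snd)[i]? = (gc₂.1.map Prod.snd)[i]? := by rw [h.mds_eq]
  simpa [h₁, h₂] using h3

theorem notMem_of_control (h : Coupled K B σ D gc₁ gc₂) (i : ℕ) {x : Var}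
    (hx : x ∈ allControlVars K) : x ∉ D i :=
  fun hi => (h.subset i hi).2 (h.control_eq x hx)

end Coupled

open Classical in
-- Coupled runs agree on control variables, so these are never overridden, and overriding leaves all
-- classifications intact.
theorem dma_piecewise {D : Set Var} (hD : ∀ x ∈ allControlVars K, x ∉ D) (σ mem : Mem Var Val)
    (x : Var) : K.dma (D.piecewise σ mem) x = K.dma mem x :=
  dma_eq_of_eqOn_controlVars (m₁ := D.piecewise σ mem) (m₂ := mem)
    (fun y hy => Set.piecewise_eq_of_notMem D σ mem (hD y hy)) x

open Classical in
/-- Overriding neither creates nor hides differences outside of the overridden variables. -/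
theorem not_readable_of_lowEqModulo {D : Set Var} (hD : ∀ x ∈ allControlVars K, x ∉ D)
    {σ m₁ m₂ : Mem Var Val} {mds : ModeState Var}
    (h : LowEqModulo K mds (D.piecewise σ m₁) (D.piecewise σ m₂))
    {x : Var} (hx : x ∈ lowDiff K m₁ m₂) (hxD : x ∉ D) : ¬ Readable mds x := by
  intro hr
  have h1 := h x (Or.inr ⟨by rw [dma_piecewise hD]; exact hx.1, hr⟩)
  rw [Set.piecewise_eq_of_notMem _ _ _ hxD, Set.piecewise_eq_of_notMem _ _ _ hxD] at h1
  exact hx.2 h1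

section Step

variable {B : ℕ → LocalConf Tps Var Val → LocalConf Tps Var Val → Prop} {σ : Mem Var Val}
  {D : ℕ → Set Var} {gc₁ gc₂ : GlobalConf Tps Var Val}

theorem Coupled.not_readable (h : Coupled K B σ D gc₁ gc₂) {i : ℕ} (hi : i < gc₁.1.length)
    (hB : StrongLowBisimMM K S (B i)) {x : Var} (hx : x ∈ lowDiff K gc₁.2 gc₂.2)
    (hxD : x ∉ D i) : ¬ Readable gc₁.1[i].2 x := by
  have hi₂ : i < gc₂.1.length := h.length_eq ▸ hi
  exact not_readable_of_lowEqModulo (fun y hy => h.notMem_of_control i hy)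
    (hB.2.2 _ _ (h.rel i hi hi₂) (h.getElem_mds_eq hi hi₂)).1.2 hx hxD

/-- The owner of `x` cannot read it and thus assumes exclusive access, which compatibility turns
into a guarantee of every other thread. This is what justifies overriding `x` for thread `k`. -/
theorem Coupled.guarNoRW (h : Coupled K B σ D gc₁ gc₂)
    (hB : ∀ i < gc₁.1.length, StrongLowBisimMM K S (B i))
    (hc : CompatibleModes (gc₁.1.map Prod.snd)) {k : ℕ} (hk : k < gc₁.1.length) {x : Var}
    (hx : x ∈ D k) : x ∈ gc₁.1[k].2 Mode.guarNoRW := by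
  obtain ⟨j, hj, hxj⟩ := h.owner x (h.subset k hx)
  have hr := h.not_readable hj (hB j hj) (h.subset k hx) hxj
  have hkj : k ≠ j := by rintro rfl; exact hxj hx
  have h1 := (hc j x (by simpa using hj)).1
  simp only [List.getElem_map, List.length_map] at h1
  exact h1 (by simpa [Readable] using hr) k hk hkj

/-- Two coupled runs can take a step of the same thread and are coupled again. -/
theorem Coupled.schedStep [Finite Var] (h : Coupled K B σ D gc₁ gc₂)
    (hB : ∀ i < gc₁.1.length, StrongLowBisimMM K S (B i))
    (hs₁ : SoundModeUse K S gc₁) (hs₂ : SoundModeUse K S gc₂) {k : ℕ}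
    {gc₁' : GlobalConf Tps Var Val} (hst : SchedStep S k gc₁ gc₁') :
    ∃ gc₂', SchedStep S k gc₂ gc₂' ∧ ∃ D', Coupled K B σ D' gc₁' gc₂' := by
  classical
  have hc := hs₁.compatible
  obtain ⟨hk, cm₁', mem₁', hst, rfl⟩ := hst
  have hk₂ : k < gc₂.1.length := h.length_eq ▸ hk
  have hmk := h.getElem_mds_eq hk hk₂
  have hR₁ := hs₁.respects hk
  have hR₂ := hs₂.respects hk₂
  have hRW₁ : ∀ x ∈ D k, DoesntRW K S gc₁.1[k].1 x := fun x hx =>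
    (hR₁ x).1 (h.guarNoRW hB hc hk hx)
  have hRW₂ : ∀ x ∈ D k, DoesntRW K S gc₂.1[k].1 x := fun x hx =>
    (hR₂ x).1 (hmk ▸ h.guarNoRW hB hc hk hx)
  obtain ⟨⟨cm₂', m₂'⟩, hst₂, hmds', hB'⟩ :=
    ((hB k hk).2.2 _ _ (h.rel k hk hk₂) hmk).2 _ (step_piecewise (D k) hRW₁ hst σ)
  -- The bisimulation supplied a step from the overridden second memory; overriding `D k` once more,
  -- by the real values, turns it into a step of the actual second run.
  have hst₂' := step_piecewise (D k) hRW₂ hst₂ gc₂.2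
  have e1 : (D k).piecewise gc₂.2 ((D k).piecewise σ gc₂.2) = gc₂.2 := by
    ext x; by_cases hx : x ∈ D k <;> simp [hx]
  rw [e1] at hst₂'
  set mem₂' := (D k).piecewise gc₂.2 m₂' with hmem₂'
  have e2 : m₂' = (D k).piecewise σ mem₂' := by
    ext x
    by_cases hx : x ∈ D k
    · simpa [hx] using ((hRW₂ x hx).eq_of_step hst₂ (Set.mem_insert _ _)).symm
    · simp [hx, hmem₂']
  rw [e2] at hB'
  have hlow' := ((hB k hk).2.2 _ _ hB' hmds').1.2
  simp only at hlow'
  have hDC := fun i (x : Var) (hx : x ∈ allControlVars K) => h.notMem_of_control i hx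
  have hctl : ∀ x ∈ allControlVars K, mem₁' x = mem₂' x := fun x hx => by
    simpa [hDC k x hx] using hlow' x (Or.inl hx)
  set X := lowDiff K gc₁.2 gc₂.2 with hX
  set X' := lowDiff K mem₁' mem₂' with hX'
  have hch : ∀ i (hi : i < gc₁.1.length), k ≠ i → ∀ x,
      (gc₁.2 x ≠ mem₁' x ∨ gc₂.2 x ≠ mem₂' x ∨ K.dma gc₁.2 x ≠ K.dma mem₁' x) →
      Writable gc₁.1[i].2 x := by
    intro i hi hki x hx
    have hi₂ : i < gc₂.1.length := h.length_eq ▸ hi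
    rcases hx with hx | hx | hx
    · exact writable_of_step hc hi hk hki hR₁ hst (Or.inl hx)
    · rw [h.getElem_mds_eq hi hi₂]
      exact writable_of_step hs₂.compatible hi₂ hk₂ hki hR₂ hst₂' (Or.inl hx)
    · exact writable_of_step hc hi hk hki hR₁ hst (Or.inr hx)
  have hXX : ∀ x, ¬ (x ∈ X ↔ x ∈ X') →
      (gc₁.2 x ≠ mem₁' x ∨ gc₂.2 x ≠ mem₂' x ∨ K.dma gc₁.2 x ≠ K.dma mem₁' x) := by
    intro x hx
    by_contra! hn
    apply hx
    simp [hX, hX', lowDiff, hn.1, hn.2.1, hn.2.2]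
  have hDk : D k ⊆ X' := by
    intro x hx
    have h1 := (hRW₁ x hx).doesntW _ _ _ _ _ hst
    have h2 := (hRW₂ x hx).doesntW _ _ _ _ _ hst₂'
    have h3 := h.subset k hx
    exact ⟨h1.2 ▸ h3.1, h1.1 ▸ h2.1 ▸ h3.2⟩
  -- For threads other than `k`, an old difference that persists keeps its status, and a new one is
  -- overridden. New differences lie outside `D k ⊆ X`, so `k` itself is their owner.
  let D' : ℕ → Set Var := fun i =>
    if i = k then D k else {x | x ∈ X' ∧ (x ∈ X → x ∈ D i)}
  have hD'k : D' k = D k := if_pos rfl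
  have hD'X : ∀ i, D' i ⊆ X' := by
    intro i
    by_cases hik : i = k
    · subst hik; rw [hD'k]; exact hDk
    · simp only [D', if_neg hik]; exact fun x hx => hx.1
  refine ⟨(gc₂.1.set k cm₂', mem₂'), ⟨hk₂, cm₂', mem₂', hst₂', rfl⟩, D', ?_⟩
  refine ⟨?_, hctl, hD'X, ?_, ?_⟩
  · simp only [List.map_set, h.mds_eq]
    congr 1
  · intro x hx
    simp only [List.length_set]
    by_cases hxk : x ∈ D k
    · obtain ⟨j, hj, hxj⟩ := h.owner x (h.subset k hxk)
      have hjk : j ≠ k := by rintro rfl; exact hxj hxk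
      refine ⟨j, hj, ?_⟩
      simp only [D', if_neg hjk]
      exact fun hx => hxj (hx.2 (h.subset k hxk))
    · exact ⟨k, hk, hD'k ▸ hxk⟩
  · intro i h₁ h₂
    simp only [List.length_set] at h₁ h₂
    by_cases hik : k = i
    · subst hik
      simp only [List.getElem_set_self]
      convert hB' using 3
    · have hD'i : D' i = {x | x ∈ X' ∧ (x ∈ X → x ∈ D i)} := if_neg (Ne.symm hik)
      simp only [List.getElem_set_ne hik]
      have hmi := h.getElem_mds_eq h₁ h₂
      have hD'C : ∀ x ∈ allControlVars K, x ∉ D' i := fun x hx hx' =>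
        (hD'X i hx').2 (hctl x hx)
      have hrel := h.rel i h₁ h₂
      rw [← Prod.mk.eta (p := gc₂.1[i]), ← hmi] at hrel
      -- Thread `i` did not step, so it is related again by cg-consistency, applied to the
      -- overridden memories.
      have key := (hB i h₁).1 gc₁.1[i].1 _ gc₂.1[i].1 _ gc₁.1[i].2 hrel
      have hcg := key ((D' i).piecewise σ mem₁') ((D' i).piecewise σ mem₂') ?_ ?_
      · have e : (gc₂.1[i].1, gc₁.1[i].2) = gc₂.1[i] := by rw [hmi]
        rw [e] at hcg
        exact hcg
      · intro x hx
        apply hch i h₁ hik x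
        rw [dma_piecewise (hDC i), dma_piecewise hD'C] at hx
        by_contra hn
        -- Where the override sets `D i` and `D' i` disagree, `x` has entered or left the low
        -- differences, which already needs a real change at `x`. Elsewhere a change of the
        -- overridden memories comes from a real one.
        have hiff : x ∈ X ↔ x ∈ X' := by
          by_contra hne
          exact hn (hXX x hne)
        have hDD : x ∈ D i ↔ x ∈ D' i := by
          rw [hD'i]
          constructor
          · exact fun hd => ⟨hiff.1 (h.subset i hd), fun _ => hd⟩
          · exact fun hd => hd.2 (hiff.2 hd.1)
        apply hn
        by_cases hd : x ∈ D i
        · simp [hd, hDD.1 hd] at hx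
          exact Or.inr (Or.inr hx)
        · simpa [hd, mt hDD.2 hd] using hx
      · rintro x (hx | ⟨hlo, hre⟩)
        · simp [hD'C x hx, hctl x hx]
        · rw [dma_piecewise hD'C] at hlo
          by_cases hd : x ∈ D' i
          · simp [hd]
          · simp only [hd, not_false_eq_true, Set.piecewise_eq_of_notMem]
            by_contra hne
            have hx' : x ∈ X' := ⟨hlo, hne⟩
            rw [hD'i] at hd
            -- A difference not overridden for `i` is an old one that `i` owned before the step; its
            -- mode state has not changed, so it still cannot read `x`.
            have : x ∈ X ∧ x ∉ D i := by
              by_contra hcon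
              exact hd ⟨hx', fun hxX => by_contra fun hxD => hcon ⟨hxX, hxD⟩⟩
            exact h.not_readable h₁ (hB i h₁) this.1 this.2 hre

theorem Coupled.evalSched [Finite Var] {s : List ℕ} :
    ∀ {D : ℕ → Set Var} {gc₁ gc₂ gc₁' : GlobalConf Tps Var Val}, Coupled K B σ D gc₁ gc₂ →
      (∀ i < gc₁.1.length, StrongLowBisimMM K S (B i)) →
      SoundModeUse K S gc₁ → SoundModeUse K S gc₂ → EvalSched S s gc₁ gc₁' →
      ∃ gc₂', EvalSched S s gc₂ gc₂' ∧ gc₁'.1.length = gc₁.1.length ∧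
        ∃ D', Coupled K B σ D' gc₁' gc₂' := by
  induction s with
  | nil => rintro D gc₁ gc₂ gc₁' h - - - rfl; exact ⟨gc₂, rfl, rfl, D, h⟩
  | cons k s ih =>
    rintro D gc₁ gc₂ gc₁' h hB hs₁ hs₂ ⟨g₁, h₁, e₁⟩
    obtain ⟨g₂, h₂, D', h'⟩ := h.schedStep hB hs₁ hs₂ h₁
    have hl : g₁.1.length = gc₁.1.length := by
      obtain ⟨_, _, _, _, rfl⟩ := h₁
      simp
    obtain ⟨gc₂', e₂, hl', hD⟩ :=
      ih h' (hl.symm ▸ hB) (hs₁.schedStep h₁) (hs₂.schedStep h₂) e₁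
    exact ⟨gc₂', ⟨g₂, h₂, e₂⟩, hl'.trans hl, hD⟩

end Step

/-- Compositionality: threads that are related to themselves by strong low bisimulations modulo
modes form a secure system, provided that modes are used soundly. -/
theorem sysSecure_of_strongLowBisimMM [Finite Var] {INIT : Mem Var Val → Prop}
    {cms : List (ThreadConf Tps Var)}
    {B : ℕ → LocalConf Tps Var Val → LocalConf Tps Var Val → Prop}
    (hB : ∀ i < cms.length, StrongLowBisimMM K S (B i))
    (hsound : ∀ mem, INIT mem → SoundModeUse K S (cms, mem))
    (hrel : ∀ (i : ℕ) (hi : i < cms.length) (mem₁ mem₂ : Mem Var Val), INIT mem₁ → INIT mem₂ →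
      LowEqModulo K cms[i].2 mem₁ mem₂ → B i (cms[i], mem₁) (cms[i], mem₂)) :
    SysSecure K S INIT cms := by
  intro mem₁ mem₂ hi₁ hi₂ hlow s cms₁' mem₁' he
  have hctl : ∀ x ∈ allControlVars K, mem₁ x = mem₂ x := fun x ⟨y, hy⟩ =>
    hlow x (K.dma_controlVars y x hy mem₁)
  -- Initially no low variable differs, so nothing is overridden and any memory can serve as `σ`.
  have h0 : Coupled K B mem₁ (fun _ => ∅) (cms, mem₁) (cms, mem₂) := by
    refine ⟨rfl, hctl, fun _ => Set.empty_subset _, fun x hx => absurd (hlow x hx.1) hx.2, ?_⟩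
    intro i h₁ _
    simp only [Set.piecewise_empty]
    refine hrel i h₁ _ _ hi₁ hi₂ ?_
    rintro x (hx | hx)
    · exact hctl x hx
    · exact hlow x hx.1
  obtain ⟨⟨cms₂', mem₂'⟩, he₂, hl, D, hD⟩ :=
    h0.evalSched hB (hsound _ hi₁) (hsound _ hi₂) he
  refine ⟨⟨_, _, he₂⟩, fun cms₂'' mem₂'' he' => ?_⟩
  cases he₂.deterministic he'
  refine ⟨hD.length_eq, hD.mds_eq, ?_⟩
  rintro x (hx | ⟨hlo, hre⟩)
  · exact hD.control_eq x hx
  · by_contra hne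
    obtain ⟨i, hi, hx⟩ := hD.owner x ⟨hlo, hne⟩
    exact hD.not_readable hi (hB i (hl ▸ hi)) ⟨hlo, hne⟩ hx (hre i hi)

end SingleLanguage

/-! ### Transfer of bisimulations and local mode use to the concrete language -/

section TwoLanguages

variable {TpsA TpsC Var Val : Type*} {K : Classification Var Val}
  {SA : Semantics TpsA Var Val} {SC : Semantics TpsC Var Val}

/-- The relation on concrete configurations induced by an abstract relation, a refinement relation
and a coupling invariant. -/
def concreteRel (B : LocalConf TpsA Var Val → LocalConf TpsA Var Val → Prop)
    (R : LocalConf TpsA Var Val → LocalConf TpsC Var Val → Prop)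
    (I : LocalConf TpsC Var Val → LocalConf TpsC Var Val → Prop)
    (lc₁ lc₂ : LocalConf TpsC Var Val) : Prop :=
  ∃ lc₁A lc₂A, B lc₁A lc₂A ∧ R lc₁A lc₁ ∧ R lc₂A lc₂ ∧ I lc₁ lc₂

theorem strongLowBisimMM_concreteRel
    {B : LocalConf TpsA Var Val → LocalConf TpsA Var Val → Prop}
    {R : LocalConf TpsA Var Val → LocalConf TpsC Var Val → Prop}
    {I : LocalConf TpsC Var Val → LocalConf TpsC Var Val → Prop}
    (hR : SecureRefinement K SA SC B R I) (hB : StrongLowBisimMM K SA B) :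
    StrongLowBisimMM K SC (concreteRel B R I) := by
  obtain ⟨hpm, hco, hcgI, hsymI, hci⟩ := hR
  refine ⟨?_, ?_, ?_⟩
  · rintro tps₁ mem₁ tps₂ mem₂ mds ⟨⟨⟨a₁, mds₁⟩, m₁⟩, ⟨⟨a₂, mds₂⟩, m₂⟩, hb, hr₁, hr₂, hi⟩
      mem₁' mem₂' hw hlow
    obtain ⟨e₁, e₁'⟩ := hpm _ _ hr₁
    obtain ⟨e₂, e₂'⟩ := hpm _ _ hr₂
    simp only at e₁ e₁' e₂ e₂'
    subst e₁ e₁' e₂ e₂'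
    have hl := (hB.2.2 _ _ hb rfl).1.2
    refine ⟨((a₁, _), mem₁'), ((a₂, _), mem₂'), hB.1 _ _ _ _ _ hb _ _ hw hlow,
      hco _ _ _ _ _ hr₁ ?_, hco _ _ _ _ _ hr₂ ?_, hcgI _ _ _ _ _ hi _ _ hw hlow⟩
    · exact fun x hx => hw x (hx.elim Or.inl fun h => Or.inr (Or.inr h))
    -- cg-consistency speaks only of classification changes in the first memory. Those in the second
    -- are the same, since control variables agree both before and after the change.
    · refine fun x hx => hw x (hx.elim (fun h => Or.inr (Or.inl h)) fun h => Or.inr (Or.inr ?_))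
      rwa [dma_eq_of_eqOn_controlVars (fun y hy => hl y (Or.inl hy)) x,
        dma_eq_of_eqOn_controlVars (fun y hy => hlow y (Or.inl hy)) x]
  · rintro lc₁ lc₂ ⟨a₁, a₂, hb, hr₁, hr₂, hi⟩
    exact ⟨a₂, a₁, hB.2.1 _ _ hb, hr₂, hr₁, hsymI _ _ hi⟩
  · rintro lc₁ lc₂ ⟨a₁, a₂, hb, hr₁, hr₂, hi⟩ hm
    obtain ⟨e₁, e₁'⟩ := hpm _ _ hr₁
    obtain ⟨e₂, e₂'⟩ := hpm _ _ hr₂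
    have hmA : SameMds a₁ a₂ := e₁.trans (hm.trans e₂.symm)
    refine ⟨⟨hm, ?_⟩, ?_⟩
    · have := (hB.2.2 _ _ hb hmA).1.2
      rwa [e₁, e₁', e₂'] at this
    · intro lc₁' hs
      obtain ⟨n, a₁', hn, hr₁', hall⟩ := hci _ _ hr₁ _ hs
      -- The abstract bisimulation provides the matching `n` steps that the cube condition takes as
      -- input.
      obtain ⟨a₂', hn₂, hm', hb'⟩ := hB.nStep hn hb hmA
      obtain ⟨lc₂', hs₂, hmC, hr₂', hi'⟩ := hall a₂ lc₂ a₂' hb hmA hr₂ hi hm hn₂ hm'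
      exact ⟨lc₂', hs₂, hmC, a₁', a₂', hb', hr₁', hr₂', hi'⟩

/-- Local mode compliance carries over from the abstract to the concrete language. -/
theorem LocalModeUse.refine {B : LocalConf TpsA Var Val → LocalConf TpsA Var Val → Prop}
    {R : LocalConf TpsA Var Val → LocalConf TpsC Var Val → Prop}
    {I : LocalConf TpsC Var Val → LocalConf TpsC Var Val → Prop}
    (hR : SecureRefinement K SA SC B R I) (hp : PreservesLocalCompliance K SA SC R)
    {lcA : LocalConf TpsA Var Val} {lcC : LocalConf TpsC Var Val} (hr : R lcA lcC)
    (hA : LocalModeUse K SA lcA) : LocalModeUse K SC lcC := by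
  obtain ⟨hpm, hco, -, -, hci⟩ := hR
  have key : ∀ lcC', LocReach K SC lcC lcC' → ∃ lcA', LocReach K SA lcA lcA' ∧ R lcA' lcC' := by
    intro lcC' h
    induction h with
    | refl => exact ⟨lcA, .refl, hr⟩
    | step _ hs ih =>
      obtain ⟨a, ha, hra⟩ := ih
      obtain ⟨n, a', hn, hra', -⟩ := hci _ _ hra _ hs
      exact ⟨a', ha.trans hn.locReach, hra'⟩
    | memDiff _ hm ih =>
      obtain ⟨⟨⟨a, mdsA⟩, memA⟩, ha, hra⟩ := ih
      obtain ⟨e, e'⟩ := hpm _ _ hra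
      simp only at e e'
      subst e e'
      exact ⟨_, ha.memDiff hm, hco _ _ _ _ _ hra hm⟩
  intro c mds mem h
  obtain ⟨⟨⟨a, mdsA⟩, memA⟩, ha, hra⟩ := key _ h
  exact hp _ _ _ _ _ _ (hA _ _ _ ha) hra

/-- Every thread of the abstract system is refined by the thread of the concrete system with the
same index. -/
def SysRel (R : ℕ → LocalConf TpsA Var Val → LocalConf TpsC Var Val → Prop)
    (cmsA : List (ThreadConf TpsA Var)) (gcC : GlobalConf TpsC Var Val) : Prop :=
  cmsA.length = gcC.1.length ∧ ∀ (i : ℕ) (hA : i < cmsA.length) (hC : i < gcC.1.length),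
    R i (cmsA[i], gcC.2) (gcC.1[i], gcC.2)

theorem SysRel.mds_eq {R : ℕ → LocalConf TpsA Var Val → LocalConf TpsC Var Val → Prop}
    {cmsA : List (ThreadConf TpsA Var)} {gcC : GlobalConf TpsC Var Val} (h : SysRel R cmsA gcC)
    (hpm : ∀ i < gcC.1.length, PreservesModesMem (R i)) :
    cmsA.map Prod.snd = gcC.1.map Prod.snd := by
  refine List.ext_getElem (by simpa using h.1) fun i h₁ h₂ => ?_
  simp only [List.length_map] at h₁ h₂
  simpa using (hpm i h₂ _ _ (h.2 i h₁ h₂)).1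

/-! ### Simulation of concrete systems by abstract ones -/

section Simulation

variable {B : ℕ → LocalConf TpsA Var Val → LocalConf TpsA Var Val → Prop}
  {R : ℕ → LocalConf TpsA Var Val → LocalConf TpsC Var Val → Prop}
  {I : ℕ → LocalConf TpsC Var Val → LocalConf TpsC Var Val → Prop}

/-- A concrete step is simulated by abstract steps of the same thread. -/
theorem SysRel.schedStep {cmsA : List (ThreadConf TpsA Var)} {gcC gcC' : GlobalConf TpsC Var Val}
    (h : SysRel R cmsA gcC)
    (hR : ∀ i < gcC.1.length, SecureRefinement K SA SC (B i) (R i) (I i))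
    (hp : ∀ i < gcC.1.length, PreservesLocalCompliance K SA SC (R i))
    (hA : SoundModeUse K SA (cmsA, gcC.2)) {k : ℕ} (hs : SchedStep SC k gcC gcC') :
    ∃ s cmsA', EvalSched SA s (cmsA, gcC.2) (cmsA', gcC'.2) ∧ SysRel R cmsA' gcC' := by
  obtain ⟨hk, cm', mem', hst, rfl⟩ := hs
  have hkA : k < cmsA.length := h.1 ▸ hk
  have hrk := h.2 k hkA hk
  obtain ⟨n, ⟨a', memA⟩, hn, hr', -⟩ := (hR k hk).2.2.2.2 _ _ hrk _ hst
  obtain ⟨-, e⟩ := (hR k hk).1 _ _ hr'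
  simp only at e
  subst e
  refine ⟨_, _, hn.evalSched hkA rfl, by simpa using h.1, ?_⟩
  intro i h₁ h₂
  simp only [List.length_set] at h₁ h₂
  by_cases hki : k = i
  · subst hki; simpa using hr'
  · simp only [List.getElem_set_ne hki]
    have hri := h.2 i h₁ h₂
    have hmi : cmsA[i].2 = gcC.1[i].2 := ((hR i h₂).1 _ _ hri).1
    have hc := hA.compatible
    -- Both systems have the same mode states, so abstract compatibility is concrete compatibility.
    -- With the guarantees inherited by the concrete thread `k`, its step is a change that `R i`
    -- tolerates.
    rw [h.mds_eq fun i hi => (hR i hi).1] at hc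
    have hg : RespectsOwnGuars K SC gcC.1[k] := hp k hk _ _ _ _ _ _ (hA.respects hkA) hrk
    have e₁ : cmsA[i] = (cmsA[i].1, gcC.1[i].2) := by rw [← hmi]
    rw [e₁] at hri ⊢
    exact (hR i h₂).2.1 _ gcC.1[i].1 _ _ _ hri fun x hx =>
      writable_of_step hc h₂ hk hki hg hst hx

/-- The abstract schedule may differ from `s`; only the mode states reached matter for
`GlobalModeUse`. -/
theorem SysRel.evalSched {s : List ℕ} :
    ∀ {cmsA : List (ThreadConf TpsA Var)} {gcC gcC' : GlobalConf TpsC Var Val},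
      SysRel R cmsA gcC →
      (∀ i < gcC.1.length, SecureRefinement K SA SC (B i) (R i) (I i)) →
      (∀ i < gcC.1.length, PreservesLocalCompliance K SA SC (R i)) →
      SoundModeUse K SA (cmsA, gcC.2) → EvalSched SC s gcC gcC' →
      ∃ t cmsA', EvalSched SA t (cmsA, gcC.2) (cmsA', gcC'.2) ∧
        cmsA'.map Prod.snd = gcC'.1.map Prod.snd := by
  induction s with
  | nil =>
    rintro cmsA gcC gcC' h hR - - rfl
    exact ⟨[], cmsA, rfl, h.mds_eq fun i hi => (hR i hi).1⟩
  | cons k s ih =>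
    rintro cmsA gcC gcC' h hR hp hA ⟨g, h₁, e₁⟩
    obtain ⟨t, cmsA₁, ht, h'⟩ := h.schedStep hR hp hA h₁
    have hl : g.1.length = gcC.1.length := by
      obtain ⟨_, _, _, _, rfl⟩ := h₁
      simp
    obtain ⟨t', cmsA', ht', hm⟩ :=
      ih h' (hl.symm ▸ hR) (hl.symm ▸ hp) (hA.evalSched ht) e₁
    exact ⟨t ++ t', cmsA', ht.append ht', hm⟩

/-- Sound mode use carries over from the abstract to the concrete system. -/
theorem SoundModeUse.refine {cmsA : List (ThreadConf TpsA Var)} {gcC : GlobalConf TpsC Var Val}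
    (hA : SoundModeUse K SA (cmsA, gcC.2)) (h : SysRel R cmsA gcC)
    (hR : ∀ i < gcC.1.length, SecureRefinement K SA SC (B i) (R i) (I i))
    (hp : ∀ i < gcC.1.length, PreservesLocalCompliance K SA SC (R i)) :
    SoundModeUse K SC gcC := by
  refine ⟨?_, ?_⟩
  · intro cm hcm
    obtain ⟨i, hi, rfl⟩ := List.mem_iff_getElem.1 hcm
    have hiA : i < cmsA.length := h.1 ▸ hi
    exact LocalModeUse.refine (hR i hi) (hp i hi) (h.2 i hiA hi)
      (hA.1 _ (List.getElem_mem hiA))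
  · rintro mdss ⟨cms', mem', s, he, rfl⟩
    obtain ⟨t, cmsA', ht, hm⟩ := h.evalSched hR hp hA he
    exact hA.2 _ ⟨cmsA', mem', t, ht, hm⟩

end Simulation

end TwoLanguages

end CVDNI

/-! ### Assembly of the main theorem -/

open CVDNI
theorem mainTheorem5 {TpsA TpsC Var Val : Type*} [Finite Var]
    (K : Classification Var Val)
    (SA : Semantics TpsA Var Val) (SC : Semantics TpsC Var Val)
    (INITA INITC : Mem Var Val → Prop)
    (cmsA : List (ThreadConf TpsA Var)) (cmsC : List (ThreadConf TpsC Var))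
    (Bs : List (LocalConf TpsA Var Val → LocalConf TpsA Var Val → Prop))
    (Rs : List (LocalConf TpsA Var Val → LocalConf TpsC Var Val → Prop))
    (Is : List (LocalConf TpsC Var Val → LocalConf TpsC Var Val → Prop))
    (hinit : ∀ mem, INITC mem → INITA mem)
    (hsound : ∀ mem, INITA mem → SoundModeUse K SA (cmsA, mem))
    (hlenA : cmsA.length = cmsC.length) (hlenB : Bs.length = cmsC.length)
    (hlenR : Rs.length = cmsC.length) (hlenI : Is.length = cmsC.length)
    (hreqs : ∀ (i : ℕ) (hi : i < cmsC.length),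
      SysRefineReqs K SA SC INITC
        (Bs[i]'(hlenB ▸ hi)) (Rs[i]'(hlenR ▸ hi)) (Is[i]'(hlenI ▸ hi)))
    (hR : ∀ (i : ℕ) (hi : i < cmsC.length) (mem : Mem Var Val), INITC mem →
      (Rs[i]'(hlenR ▸ hi)) (cmsA[i]'(hlenA ▸ hi), mem) (cmsC[i], mem))
    (hB : ∀ (i : ℕ) (hi : i < cmsC.length) (mem₁ mem₂ : Mem Var Val),
      INITA mem₁ → INITA mem₂ → LowEqModulo K (cmsC[i].2) mem₁ mem₂ →
      (Bs[i]'(hlenB ▸ hi)) (cmsA[i]'(hlenA ▸ hi), mem₁) (cmsA[i]'(hlenA ▸ hi), mem₂)) :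
    SysSecure K SC INITC cmsC ∧
      ∀ mem, INITC mem → GlobalModeUse SC (cmsC, mem) := by
  -- The lists become families over `ℕ`; the empty relation beyond the last thread is a default
  -- value that is never consulted.
  let B : ℕ → LocalConf TpsA Var Val → LocalConf TpsA Var Val → Prop := fun i =>
    if hi : i < cmsC.length then Bs[i]'(hlenB ▸ hi) else fun _ _ => False
  let R : ℕ → LocalConf TpsA Var Val → LocalConf TpsC Var Val → Prop := fun i =>
    if hi : i < cmsC.length then Rs[i]'(hlenR ▸ hi) else fun _ _ => False
  let I : ℕ → LocalConf TpsC Var Val → LocalConf TpsC Var Val → Prop := fun i =>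
    if hi : i < cmsC.length then Is[i]'(hlenI ▸ hi) else fun _ _ => False
  have hreqs' : ∀ i < cmsC.length, SysRefineReqs K SA SC INITC (B i) (R i) (I i) := by
    intro i hi
    simpa only [B, R, I, dif_pos hi] using hreqs i hi
  have hR' : ∀ mem, INITC mem → SysRel R cmsA (cmsC, mem) := by
    refine fun mem hm => ⟨hlenA, fun i _ hi => ?_⟩
    simpa only [R, dif_pos hi] using hR i hi mem hm
  have hB' : ∀ (i : ℕ) (hi : i < cmsC.length) (mem₁ mem₂ : Mem Var Val),
      INITA mem₁ → INITA mem₂ → LowEqModulo K (cmsC[i].2) mem₁ mem₂ →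
      B i (cmsA[i]'(hlenA ▸ hi), mem₁) (cmsA[i]'(hlenA ▸ hi), mem₂) := by
    intro i hi
    simpa only [B, dif_pos hi] using hB i hi
  have hsC : ∀ mem, INITC mem → SoundModeUse K SC (cmsC, mem) := fun mem hm =>
    SoundModeUse.refine (B := B) (R := R) (I := I) (gcC := (cmsC, mem)) (hsound mem (hinit mem hm))
      (hR' mem hm) (fun i hi => (hreqs' i hi).1) fun i hi => (hreqs' i hi).2.2.1
  refine ⟨?_, fun mem hm => (hsC mem hm).2⟩
  refine sysSecure_of_strongLowBisimMM (B := fun i => concreteRel (B i) (R i) (I i))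
    (fun i hi => strongLowBisimMM_concreteRel (hreqs' i hi).1 (hreqs' i hi).2.1) hsC ?_
  intro i hi mem₁ mem₂ h₁ h₂ hl
  exact ⟨_, _, hB' i hi mem₁ mem₂ (hinit _ h₁) (hinit _ h₂) hl,
    (hR' mem₁ h₁).2 i (hlenA ▸ hi) hi, (hR' mem₂ h₂).2 i (hlenA ▸ hi) hi,
    (hreqs' i hi).2.2.2 _ _ _ _ hl h₁ h₂⟩
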